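/- Let $p$ be a prime number with $p \equiv 1 \pmod 4$, and let $\mathrm{Paley}(p)$ be the graph with vertex set $X = \mathbb{Z}/p\mathbb{Z}$ in which $x$ and $y$ are adjacent if and only if $x - y$ is a nonzero square. Let $A \in M_X(\mathbb{C})$ be its adjacency matrix; for $Y \subseteq X$ let $E_Y \in M_X(\mathbb{C})$ be the diagonal matrix whose $(x,x)$-entry is $1$ if $x \in Y$ and $0$ otherwise; and let $G_0$ be the stabilizer of the vertex $0$ in the automorphism group of $\mathrm{Paley}(p)$. Define the following unital $\mathbb{C}$-subalgebras of $M_X(\mathbb{C})$: - $\mathcal{T}_1(\mathrm{Paley}(p))$ is generated by $A$ and $E_{\{0\}}$; - $\mathcal{T}_2(\mathrm{Paley}(p))$ is generated by $A$ and all $E_{X_k}$, $k \ge 0$, where $X_k$ is the set of vertices at distance $k$ from $0$; - $\mathcal{T}_3(\mathrm{Paley}(p))$ is generated by $A$ and all $E_Y$, where $Y$ runs over the $G_0$-orbits on $X$; - $\mathcal{T}_4(\mathrm{Paley}(p))$ consists of all $M \in M_X(\mathbb{C})$ with $M_{\sigma(x),\sigma(y)} = M_{x,y}$ for all $\sigma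 \in G_0$ and all $x, y \in X$. Then, for every prime $p \ge 7$ with $p \equiv 1 \pmod 4$, $$\mathcal{T}_1(\mathrm{Paley}(p)) \subsetneq \mathcal{T}_2(\mathrm{Paley}(p)) = \mathcal{T}_3(\mathrm{Paley}(p)) \subsetneq \mathcal{T}_4(\mathrm{Paley}(p)).$$ Moreover, there are infinitely many primes $p \equiv 1 \pmod 4$ with $\mathcal{T}_3(\mathrm{Paley}(p)) \ne \mathcal{T}_4(\mathrm{Paley}(p))$. -/

import Mathlib

noncomputable section

namespace TerwilligerPaley

section Algebras

variable {V : Type*} [Fintype V] [DecidableEq V]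

/-- The adjacency matrix `A` of `Γ`, with complex entries. -/
def adjMat (Γ : SimpleGraph V) : Matrix V V ℂ :=
  open Classical in Γ.adjMatrix ℂ

/-- The diagonal `0`-`1` matrix `E_Y` of a set `Y` of vertices. -/
def diagIdem (Y : Set V) : Matrix V V ℂ :=
  Matrix.diagonal (Y.indicator 1)

/-- The set of vertices at distance `k` from `x₀` (`edist` is `∞` if there is no walk). -/
def sphere (Γ : SimpleGraph V) (x₀ : V) (k : ℕ) : Set V :=
  {x | Γ.edist x₀ x = k}

/-- The stabilizer of `x₀` in the automorphism group of `Γ`. -/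
abbrev autStab (Γ : SimpleGraph V) (x₀ : V) : Subgroup (Γ ≃g Γ) :=
  MulAction.stabilizer (Γ ≃g Γ) x₀

/-- The algebra generated by `A` and `E_{x₀}`. -/
def T₁ (Γ : SimpleGraph V) (x₀ : V) : Subalgebra ℂ (Matrix V V ℂ) :=
  Algebra.adjoin ℂ {adjMat Γ, diagIdem {x₀}}

/-- The Terwilliger algebra, generated by `A` and the `E_Y` for the classes `Y` of the distance
partition with respect to `x₀`. For `k` larger than the maximal distance from `x₀` the sphere is
empty and contributes the zero matrix. -/
def T₂ (Γ : SimpleGraph V) (x₀ : V) : Subalgebra ℂ (Matrix V V ℂ) :=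
  Algebra.adjoin ℂ ({adjMat Γ} ∪ Set.range fun k : ℕ => diagIdem (sphere Γ x₀ k))

/-- The algebra generated by `A` and the `E_Y` for the orbits `Y` of the stabilizer of `x₀` in the
automorphism group. -/
def T₃ (Γ : SimpleGraph V) (x₀ : V) : Subalgebra ℂ (Matrix V V ℂ) :=
  Algebra.adjoin ℂ
    ({adjMat Γ} ∪ Set.range fun y : V => diagIdem (MulAction.orbit (autStab Γ x₀) y))

/-- The centralizer algebra: the matrices that are invariant under the simultaneous permutation of
rows and columns by every automorphism fixing `x₀`. -/
def T₄ (Γ : SimpleGraph V) (x₀ : V) : Subalgebra ℂ (Matrix V V ℂ) where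
  carrier := {M | ∀ σ ∈ autStab Γ x₀, ∀ x y : V, M (σ x) (σ y) = M x y}
  mul_mem' := by
    intro M N hM hN σ hσ x y
    rw [Matrix.mul_apply, Matrix.mul_apply,
      ← Equiv.sum_comp σ.toEquiv fun z => M (σ x) z * N z (σ y)]
    refine Finset.sum_congr rfl fun z _ => ?_
    exact congrArg₂ (· * ·) (hM σ hσ x z) (hN σ hσ z y)
  add_mem' := by
    intro M N hM hN σ hσ x y
    rw [Matrix.add_apply, Matrix.add_apply, hM σ hσ, hN σ hσ]
  algebraMap_mem' := by
    intro c σ hσ x y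
    simp [Matrix.algebraMap_matrix_apply]

end Algebras

section Paley

/-- The Paley graph on a finite field `F` with `|F| ≡ 1 (mod 4)`: two vertices are adjacent if and
only if their difference is a nonzero square. -/
def paleyGraph (F : Type*) [Field F] [Fintype F] (hF : Fintype.card F % 4 = 1) :
    SimpleGraph F where
  Adj x y := x ≠ y ∧ IsSquare (x - y)
  symm := ⟨by
    rintro x y ⟨hne, hsq⟩
    refine ⟨hne.symm, ?_⟩
    have h : IsSquare (-1 : F) := FiniteField.isSquare_neg_one_iff.2 (by omega)
    have h' := h.mul hsq
    rwa [neg_one_mul, neg_sub] at h'⟩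
  loopless := ⟨fun x h => h.1 rfl⟩

/-- The Paley graph on `p` vertices, for a prime number `p ≡ 1 (mod 4)`. -/
def paley (p : ℕ) [Fact p.Prime] (hp : p % 4 = 1) : SimpleGraph (ZMod p) :=
  paleyGraph (ZMod p) (by rw [ZMod.card]; exact hp)

end Paley

end TerwilligerPaley

end

/-!
Let `χ` be the quadratic character of a finite field `F` with `q ≡ 1 (mod 4)` elements, and call a
matrix biinvariant if it is unchanged when its rows and its columns are multiplied by nonzero
squares, independently; its `(x, y)`-entry then depends on `χ x` and `χ y` only. Up to the identity
and the all-ones matrix `J`, the adjacency matrix is half the Jacobsthal matrix `Q = (χ (x - y))`.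

* `T₁`: as `Q² = q - J`, the span of `1`, `Q` and the biinvariant matrices is an algebra. It
  contains `T₁`, but a diagonal matrix in it is constant off `0`, which `E_{X₁}` is not.
* `T₂ = T₃`: multiplications by nonzero squares are automorphisms, so the stabilizer of `0` is
  transitive on each of the spheres `{0}`, the nonzero squares and the nonsquares.
* `T₃`: the inversion `x ↦ x⁻¹`, twisted by `χ`, almost commutes with `Q` because
  `χ x * χ (x⁻¹ - y) = χ y * χ (x - y⁻¹)` for nonzero `x`, `y`. Hence every element of `T₃`
  commutes with the twisted inversion modulo biinvariant matrices, whereas the matrix of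
  `x ↦ s² x` does not if `s⁴ ≠ 1`.
* `T₄`: for prime `q`, an automorphism `σ` fixing `0` is multiplication by a constant (Carlitz),
  hence commutes with all dilations, whose matrices therefore lie in `T₄`. Indeed `x ↦ σ x - c x`
  is injective for every `c` with `χ c ≠ 1`, so the power sum `∑ (σ x - c x) ^ n` vanishes for more
  than `q / 2` values of `c`. As a polynomial in `c` it is zero if `n ≤ q / 2`, which yields
  `∑ (σ x) ^ i * x ^ j = 0` for `i + j ≤ q / 2`. If `σ` had degree `d ≥ 2` as a polynomial, some
  such product `σ ^ i * x ^ j` would have degree exactly `q - 1`, and its sum would be nonzero.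
-/

namespace TerwilligerPaley

section PowerSums

open Polynomial

variable {K : Type*} [Field K] [Fintype K]

theorem sum_eval_eq_neg_coeff {q : K[X]} (hq : q.natDegree ≤ Fintype.card K - 1) :
    ∑ x, q.eval x = -q.coeff (Fintype.card K - 1) := by
  classical
  have hcard : Fintype.card K - 1 ≠ 0 := (Nat.sub_pos_of_lt Fintype.one_lt_card).ne'
  have sum_pow_card_sub_one : ∑ x : K, x ^ (Fintype.card K - 1) = -1 := by
    have hpow (x : K) : x ^ (Fintype.card K - 1) = 1 - if x = 0 then 1 else 0 := by
      split_ifs with hx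
      · rw [hx, zero_pow hcard, sub_self]
      · rw [FiniteField.pow_card_sub_one_eq_one x hx, sub_zero]
    simp [hpow]
  simp_rw [eval_eq_sum_range' (Nat.lt_succ_of_le hq)]
  rw [Finset.sum_comm, Finset.sum_range_succ, Finset.sum_eq_zero, zero_add, ← Finset.mul_sum,
    sum_pow_card_sub_one, mul_neg_one]
  intro i hi
  rw [← Finset.mul_sum, FiniteField.sum_pow_lt_card_sub_one K i (Finset.mem_range.1 hi), mul_zero]

theorem sum_pow_mul_pow_eq_zero {f : K → K} {S : Finset K}
    (hS : ∀ c ∈ S, Function.Injective fun x => f x - c * x) {i j : ℕ} (hcard : i + j < S.card)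
    (hlt : i + j < Fintype.card K - 1) (hchoose : ((i + j).choose j : K) ≠ 0) :
    ∑ x, f x ^ i * x ^ j = 0 := by
  -- The value of `P` at `c` is the power sum of the values of `x ↦ f x - c * x`.
  let P : K[X] := ∑ x, ((X + C (f x)) ^ (i + j)).comp (C (-x) * X)
  have hdeg : P.natDegree < S.card := by
    refine (natDegree_sum_le_of_forall_le _ _ fun x _ => ?_).trans_lt hcard
    refine natDegree_comp_le.trans ?_
    calc ((X + C (f x)) ^ (i + j)).natDegree * (C (-x) * X).natDegree
        ≤ (i + j) * 1 := by
          gcongr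
          · rw [natDegree_pow, natDegree_X_add_C, mul_one]
          · exact natDegree_C_mul_le _ _ |>.trans natDegree_X_le
      _ = i + j := mul_one _
  have hP : P = 0 := by
    refine eq_zero_of_natDegree_lt_card_of_eval_eq_zero' P S (fun c hc => ?_) hdeg
    calc P.eval c = ∑ x, (f x - c * x) ^ (i + j) := by
          rw [eval_finsetSum]
          refine Finset.sum_congr rfl fun x _ => ?_
          simp only [eval_comp, eval_pow, eval_add, eval_mul, eval_X, eval_C]
          ring
      _ = ∑ y, y ^ (i + j) := (hS c hc).bijective_of_finite.sum_comp fun y => y ^ (i + j)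
      _ = 0 := FiniteField.sum_pow_lt_card_sub_one K _ hlt
  have hcoeff : P.coeff j = (∑ x, f x ^ i * x ^ j) * ((-1) ^ j * ((i + j).choose j : K)) := by
    rw [finsetSum_coeff, Finset.sum_mul]
    refine Finset.sum_congr rfl fun x _ => ?_
    rw [comp_C_mul_X_coeff, coeff_X_add_C_pow, Nat.add_sub_cancel, neg_pow]
    ring
  rw [hP, coeff_zero] at hcoeff
  simpa [hchoose] using hcoeff.symm

theorem exists_mul_add_eq_and_two_mul_add_le {d n : ℕ} (hd : 2 ≤ d) (hdn : d ≤ n) :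
    ∃ a b, a * d + b = n ∧ 2 * (a + b) ≤ n + 1 := by
  refine ⟨n / d, n % d, Nat.div_add_mod' n d, ?_⟩
  obtain ⟨e, rfl⟩ := Nat.exists_eq_add_of_le hd
  have hdiv : 1 ≤ n / (2 + e) := (Nat.one_le_div_iff (by omega)).2 hdn
  have hmod := Nat.mod_lt n (show 0 < 2 + e by omega)
  have hn := Nat.div_add_mod n (2 + e)
  nlinarith [Nat.mul_le_mul_right e hdiv]

omit [Fintype K] in
theorem natCast_choose_ne_zero {p : ℕ} [CharP K p] (hp : p.Prime) {n k : ℕ} (hn : n < p)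
    (hk : k ≤ n) : (n.choose k : K) ≠ 0 := by
  rw [Ne, CharP.cast_eq_zero_iff K p, ← hp.coprime_iff_not_dvd]
  exact hp.coprime_choose_of_lt hn hk

theorem natDegree_le_one_of_injective_sub_mul (hprime : (Fintype.card K).Prime) {g : K[X]}
    (hg : g.natDegree ≤ Fintype.card K - 1) {S : Finset K} (hcard : Fintype.card K < 2 * S.card)
    (hS : ∀ c ∈ S, Function.Injective fun x => g.eval x - c * x) : g.natDegree ≤ 1 := by
  by_contra! hd
  have := Fact.mk hprime
  have : CharP K (Fintype.card K) := charP_of_card_eq_prime rfl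
  have hg0 : g ≠ 0 := ne_zero_of_natDegree_gt hd
  -- `g ^ a * X ^ b` has degree exactly `card K - 1`, although `a + b` is small.
  obtain ⟨a, b, hn, hab⟩ := exists_mul_add_eq_and_two_mul_add_le hd hg
  have hdeg : (g ^ a * X ^ b).natDegree = Fintype.card K - 1 := by
    rw [natDegree_mul (pow_ne_zero _ hg0) (pow_ne_zero _ X_ne_zero), natDegree_pow,
      natDegree_X_pow, hn]
  have hsum : ∑ x, (g ^ a * X ^ b).eval x = 0 := by
    simp_rw [eval_mul, eval_pow, eval_X]
    exact sum_pow_mul_pow_eq_zero hS (by omega) (by omega)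
      (natCast_choose_ne_zero hprime (by omega) (by omega))
  rw [sum_eval_eq_neg_coeff hdeg.le, ← hdeg, coeff_natDegree, neg_eq_zero,
    leadingCoeff_eq_zero] at hsum
  exact mul_ne_zero (pow_ne_zero _ hg0) (pow_ne_zero _ X_ne_zero) hsum

theorem exists_eq_mul_add_of_injective_sub_mul (hprime : (Fintype.card K).Prime) {f : K → K}
    {S : Finset K} (hcard : Fintype.card K < 2 * S.card)
    (hS : ∀ c ∈ S, Function.Injective fun x => f x - c * x) :
    ∃ a b, ∀ x, f x = a * x + b := by
  classical
  let g : K[X] := Lagrange.interpolate Finset.univ id f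
  have hg (x : K) : g.eval x = f x :=
    Lagrange.eval_interpolate_at_node f (Set.injOn_id _) (Finset.mem_univ x)
  have hdeg : g.natDegree ≤ Fintype.card K - 1 :=
    natDegree_le_of_degree_le (Lagrange.degree_interpolate_le f (Set.injOn_id _))
  obtain ⟨a, b, hab⟩ := exists_eq_X_add_C_of_natDegree_le_one
    (natDegree_le_one_of_injective_sub_mul hprime hdeg hcard (by simpa only [hg] using hS))
  exact ⟨a, b, fun x => by rw [← hg, hab]; simp⟩

end PowerSums

section GeneralGraphs

variable {V : Type*} [DecidableEq V]

open Classical in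
theorem diagIdem_apply (Y : Set V) (x y : V) :
    diagIdem Y x y = if x = y ∧ x ∈ Y then 1 else 0 := by
  by_cases h : x = y <;> simp [diagIdem, Set.indicator_apply, h]

theorem diagIdem_empty : diagIdem (∅ : Set V) = 0 := by
  simp [diagIdem]

omit [DecidableEq V] in
theorem smul_mem_orbit_iff {G : Type*} [Group G] [MulAction G V] (g : G) {x y : V} :
    g • x ∈ MulAction.orbit G y ↔ x ∈ MulAction.orbit G y := by
  rw [← MulAction.orbit_eq_iff, MulAction.orbit_smul, MulAction.orbit_eq_iff]

omit [DecidableEq V] in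
theorem edist_iso_le {Γ : SimpleGraph V} (σ : Γ ≃g Γ) (x y : V) :
    Γ.edist (σ x) (σ y) ≤ Γ.edist x y :=
  le_sInf <| by
    rintro _ ⟨w, rfl⟩
    simpa using (w.map σ.toHom).edist_le

omit [DecidableEq V] in
theorem edist_iso {Γ : SimpleGraph V} (σ : Γ ≃g Γ) (x y : V) :
    Γ.edist (σ x) (σ y) = Γ.edist x y :=
  (edist_iso_le σ x y).antisymm <| by simpa using edist_iso_le σ.symm (σ x) (σ y)

omit [DecidableEq V] in
theorem sphere_eq_orbit {Γ : SimpleGraph V} {x₀ y : V} {k : ℕ} (hk : Γ.edist x₀ y = k)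
    (htrans : ∀ x, Γ.edist x₀ x = Γ.edist x₀ y → x ∈ MulAction.orbit (autStab Γ x₀) y) :
    sphere Γ x₀ k = MulAction.orbit (autStab Γ x₀) y := by
  refine Set.Subset.antisymm (fun x hx => htrans x (Eq.trans hx hk.symm)) ?_
  rintro _ ⟨⟨σ, hσ : σ x₀ = x₀⟩, rfl⟩
  calc Γ.edist x₀ (σ y) = Γ.edist (σ x₀) (σ y) := by rw [hσ]
    _ = k := (edist_iso σ x₀ y).trans hk

variable [Fintype V]

theorem T₁_le_T₂ (Γ : SimpleGraph V) (x₀ : V) : T₁ Γ x₀ ≤ T₂ Γ x₀ := by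
  have hsphere : sphere Γ x₀ 0 = {x₀} := by
    ext x
    change Γ.edist x₀ x = 0 ↔ x = x₀
    rw [SimpleGraph.edist_eq_zero_iff, eq_comm]
  refine Algebra.adjoin_mono (Set.insert_subset (Or.inl rfl) ?_)
  exact Set.singleton_subset_iff.2 (Or.inr ⟨0, congrArg diagIdem hsphere⟩)

theorem T₂_eq_T₃_of_transitive_on_spheres {Γ : SimpleGraph V} (hΓ : Γ.Preconnected) {x₀ : V}
    (htrans : ∀ x y, Γ.edist x₀ x = Γ.edist x₀ y → x ∈ MulAction.orbit (autStab Γ x₀) y) :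
    T₂ Γ x₀ = T₃ Γ x₀ := by
  apply le_antisymm
  · refine Algebra.adjoin_le ?_
    rintro _ (rfl | ⟨k, rfl⟩)
    · exact Algebra.subset_adjoin (Or.inl rfl)
    · obtain hk | ⟨y, hy⟩ := (sphere Γ x₀ k).eq_empty_or_nonempty
      · simp only [hk, diagIdem_empty]
        exact (T₃ Γ x₀).zero_mem
      · refine Algebra.subset_adjoin (Or.inr ⟨y, ?_⟩)
        simp only [sphere_eq_orbit hy fun x => htrans x y]
  · refine Algebra.adjoin_mono (Set.union_subset_union_right _ ?_)
    rintro _ ⟨y, rfl⟩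
    obtain ⟨k, hk⟩ := ENat.ne_top_iff_exists.1
      (SimpleGraph.edist_ne_top_iff_reachable.2 (hΓ x₀ y))
    exact ⟨k, congrArg diagIdem (sphere_eq_orbit hk.symm fun x => htrans x y)⟩

theorem T₃_le_T₄ (Γ : SimpleGraph V) (x₀ : V) : T₃ Γ x₀ ≤ T₄ Γ x₀ := by
  classical
  refine Algebra.adjoin_le ?_
  rintro _ (rfl | ⟨y, rfl⟩) σ hσ x z
  · exact if_congr σ.map_adj_iff rfl rfl
  · have horbit := smul_mem_orbit_iff (⟨σ, hσ⟩ : autStab Γ x₀) (x := x) (y := y)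
    simp only [diagIdem_apply]
    exact if_congr (and_congr σ.injective.eq_iff horbit) rfl rfl

end GeneralGraphs

section Invariance

open Matrix

variable (R G V : Type*) [CommRing R] [Group G] [MulAction G V]

/-- The `G`-biinvariant matrices over `R`: those invariant under the action of `G` on the rows and,
independently, on the columns. -/
def biinvariantMatrices : Submodule R (Matrix V V R) where
  carrier := {M | ∀ (g h : G) (x y : V), M (g • x) (h • y) = M x y}
  zero_mem' _ _ _ _ := rfl
  add_mem' hM hN g h x y := by rw [Matrix.add_apply, Matrix.add_apply, hM, hN]
  smul_mem' c _ hM g h x y := by rw [Matrix.smul_apply, Matrix.smul_apply, hM]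

variable [Fintype V] [DecidableEq V]

/-- The `G`-invariant matrices over `R`: those invariant under the simultaneous action of `G` on
the rows and the columns. -/
def invariantMatrices : Subalgebra R (Matrix V V R) where
  carrier := {M | ∀ (g : G) (x y : V), M (g • x) (g • y) = M x y}
  mul_mem' {M N} hM hN g x y := by
    rw [mul_apply, mul_apply, ← (MulAction.bijective g).sum_comp]
    exact Finset.sum_congr rfl fun z _ => by rw [hM, hN]
  add_mem' hM hN g x y := by rw [Matrix.add_apply, Matrix.add_apply, hM, hN]
  algebraMap_mem' c g x y := by simp [algebraMap_matrix_apply]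

variable {R G V}

theorem mem_invariantMatrices_of_mem_biinvariantMatrices {M : Matrix V V R}
    (hM : M ∈ biinvariantMatrices R G V) : M ∈ invariantMatrices R G V :=
  fun g => hM g g

theorem mul_mem_biinvariantMatrices_left {M N : Matrix V V R}
    (hM : M ∈ invariantMatrices R G V) (hN : N ∈ biinvariantMatrices R G V) :
    M * N ∈ biinvariantMatrices R G V := fun g h x y => by
  rw [mul_apply, mul_apply, ← (MulAction.bijective g).sum_comp]
  exact Finset.sum_congr rfl fun z _ => by rw [hM, hN]

theorem mul_mem_biinvariantMatrices_right {M N : Matrix V V R}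
    (hM : M ∈ biinvariantMatrices R G V) (hN : N ∈ invariantMatrices R G V) :
    M * N ∈ biinvariantMatrices R G V := fun g h x y => by
  rw [mul_apply, mul_apply, ← (MulAction.bijective h).sum_comp]
  exact Finset.sum_congr rfl fun z _ => by rw [hM, hN]

variable (G) in
/-- The `G`-invariant matrices that commute with `T` modulo the `G`-biinvariant matrices. The matrix
`T` itself need not be `G`-invariant. For `T` the twisted inversion, this algebra contains `T₃`. -/
def centralizerModBiinvariant (T : Matrix V V R) : Subalgebra R (Matrix V V R) where
  carrier := {M | M ∈ invariantMatrices R G V ∧ T * M - M * T ∈ biinvariantMatrices R G V}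
  mul_mem' {M N} hM hN := by
    refine ⟨mul_mem hM.1 hN.1, ?_⟩
    have hleibniz : T * (M * N) - M * N * T = (T * M - M * T) * N + M * (T * N - N * T) := by
      noncomm_ring
    rw [hleibniz]
    exact add_mem (mul_mem_biinvariantMatrices_right hM.2 hN.1)
      (mul_mem_biinvariantMatrices_left hM.1 hN.2)
  add_mem' {M N} hM hN := by
    refine ⟨add_mem hM.1 hN.1, ?_⟩
    rw [mul_add, add_mul, add_sub_add_comm]
    exact add_mem hM.2 hN.2
  algebraMap_mem' c := by
    refine ⟨algebraMap_mem _ c, ?_⟩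
    rw [Algebra.commutes, sub_self]
    exact zero_mem _

end Invariance

section QuadraticCharacter

open MulAction

variable {F : Type*} [Field F]

theorem exists_eq_sq_sub_sq (hF2 : ringChar F ≠ 2) (x : F) : ∃ u v : F, x = u ^ 2 - v ^ 2 := by
  have h2 : (2 : F) ≠ 0 := Ring.two_ne_zero hF2
  exact ⟨(x + 1) / 2, (x - 1) / 2, by field_simp; ring⟩

variable [Fintype F]

theorem ringChar_ne_two_of_card_mod_four (hF : Fintype.card F % 4 = 1) : ringChar F ≠ 2 :=
  fun h => by have := FiniteField.even_card_of_char_two h; omega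

variable [DecidableEq F]

theorem quadraticChar_neg_one_of_card_mod_four (hF : Fintype.card F % 4 = 1) :
    quadraticChar F (-1) = 1 :=
  (quadraticChar_one_iff_isSquare (neg_ne_zero.2 one_ne_zero)).2
    (FiniteField.isSquare_neg_one_iff.2 (by omega))

theorem quadraticChar_neg_of_card_mod_four (hF : Fintype.card F % 4 = 1) (x : F) :
    quadraticChar F (-x) = quadraticChar F x := by
  rw [← neg_one_mul, map_mul, quadraticChar_neg_one_of_card_mod_four hF, one_mul]

theorem quadraticChar_inv (x : F) : quadraticChar F x⁻¹ = quadraticChar F x := by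
  rw [← MulChar.inv_apply', (quadraticChar_isQuadratic F).inv]

theorem quadraticChar_square_smul (g : Subgroup.square Fˣ) (x : F) :
    quadraticChar F (g • x) = quadraticChar F x := by
  have hg : IsSquare ((g : Fˣ) : F) := g.2.map (Units.coeHom F)
  rw [Subgroup.smul_def, Units.smul_def, smul_eq_mul, map_mul,
    (quadraticChar_one_iff_isSquare (Units.ne_zero _)).2 hg, one_mul]

theorem mem_orbit_square_iff {x y : F} :
    x ∈ orbit (Subgroup.square Fˣ) y ↔ quadraticChar F x = quadraticChar F y := by
  constructor
  · rintro ⟨g, rfl⟩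
    exact quadraticChar_square_smul g y
  · intro h
    obtain rfl | hy := eq_or_ne y 0
    · rw [quadraticChar_zero, quadraticChar_eq_zero_iff] at h
      rw [h]
      exact mem_orbit_self 0
    · have hsq : quadraticChar F (x * y⁻¹) = 1 := by
        rw [map_mul, quadraticChar_inv, h, ← sq, quadraticChar_sq_one hy]
      have hxy : x * y⁻¹ ≠ 0 := fun h0 => by simp [h0] at hsq
      obtain ⟨r, hr⟩ := (quadraticChar_one_iff_isSquare hxy).1 hsq
      have hr0 : r ≠ 0 := fun h0 => hxy (by rw [hr, h0, mul_zero])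
      refine ⟨⟨Units.mk0 r hr0 * Units.mk0 r hr0, Units.mk0 r hr0, rfl⟩, ?_⟩
      change r * r * y = x
      rw [← hr, inv_mul_cancel_right₀ hy]

theorem quadraticChar_eq_quadraticChar {a b : F} (h0 : a = 0 ↔ b = 0)
    (h1 : quadraticChar F a = 1 ↔ quadraticChar F b = 1) :
    quadraticChar F a = quadraticChar F b := by
  by_cases ha : a = 0
  · rw [ha, h0.1 ha]
  · have hb := mt h0.2 ha
    rcases quadraticChar_dichotomy ha with h | h
    · rw [h, h1.1 h]
    · rcases quadraticChar_dichotomy hb with h' | h'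
      · rw [h', h1.2 h']
      · rw [h, h']

theorem two_mul_card_quadraticChar_ne_one (hF2 : ringChar F ≠ 2) :
    2 * (Finset.univ.filter fun c : F => quadraticChar F c ≠ 1).card = Fintype.card F + 1 := by
  have hterm (c : F) : (if quadraticChar F c ≠ 1 then 2 else 0 : ℤ) =
      1 - quadraticChar F c + if c = 0 then 1 else 0 := by
    obtain rfl | hc := eq_or_ne c 0
    · simp
    · rcases quadraticChar_dichotomy hc with h | h <;> simp [h, hc, -quadraticChar_apply]
  have hsum := Finset.sum_congr rfl fun c (_ : c ∈ Finset.univ) => hterm c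
  rw [← Finset.sum_filter, Finset.sum_add_distrib, Finset.sum_sub_distrib,
    quadraticChar_sum_zero hF2] at hsum
  simp only [Finset.sum_const, nsmul_eq_mul, Finset.card_univ, mul_one, sub_zero,
    Finset.sum_ite_eq', Finset.mem_univ, if_true] at hsum
  rw [mul_comm]
  exact_mod_cast hsum

theorem sum_quadraticChar_sub_mul_quadraticChar_sub (hF2 : ringChar F ≠ 2) (x y : F) :
    ∑ z, quadraticChar F (x - z) * quadraticChar F (z - y) =
      quadraticChar F (-1) * if x = y then (Fintype.card F : ℤ) - 1 else -1 := by
  split_ifs with h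
  · subst h
    have hterm (w : F) : quadraticChar F w * quadraticChar F (-w) =
        quadraticChar F (-1) * (1 - if w = 0 then 1 else 0) := by
      obtain rfl | hw := eq_or_ne w 0
      · simp
      · rw [← neg_one_mul w, map_mul, mul_left_comm, ← sq, quadraticChar_sq_one hw]
        simp [hw]
    calc ∑ z, quadraticChar F (x - z) * quadraticChar F (z - x)
        = ∑ w, quadraticChar F w * quadraticChar F (-w) := by
          rw [← (Equiv.subLeft x).sum_comp]
          simp only [Equiv.subLeft_apply, sub_sub_cancel, sub_sub_cancel_left]
      _ = quadraticChar F (-1) * (Fintype.card F - 1) := by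
          simp only [hterm, ← Finset.mul_sum, Finset.sum_sub_distrib, Finset.sum_const,
            Finset.card_univ, nsmul_eq_mul, mul_one, Finset.sum_ite_eq', Finset.mem_univ, if_true]
  · have hsub := sub_ne_zero.2 h
    calc ∑ z, quadraticChar F (x - z) * quadraticChar F (z - y)
        = ∑ w, quadraticChar F (x - (y + (x - y) * w)) *
            quadraticChar F (y + (x - y) * w - y) :=
          (((Equiv.mulLeft₀ _ hsub).trans (Equiv.addLeft y)).sum_comp
            fun z => quadraticChar F (x - z) * quadraticChar F (z - y)).symm
      _ = jacobiSum (quadraticChar F) (quadraticChar F)⁻¹ := by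
          rw [(quadraticChar_isQuadratic F).inv, jacobiSum_comm, jacobiSum]
          refine Finset.sum_congr rfl fun w _ => ?_
          have hsq := quadraticChar_sq_one hsub
          rw [add_sub_cancel_left, show x - (y + (x - y) * w) = (x - y) * (1 - w) by ring,
            map_mul, map_mul]
          linear_combination (quadraticChar F (1 - w) * quadraticChar F w) * hsq
      _ = quadraticChar F (-1) * -1 := by
          rw [jacobiSum_nontrivial_inv (quadraticChar_ne_one hF2), mul_neg_one]

theorem mem_biinvariantMatrices_square_iff {R : Type*} [CommRing R] {M : Matrix F F R} :
    M ∈ biinvariantMatrices R (Subgroup.square Fˣ) F ↔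
      ∀ x x' y y', quadraticChar F x = quadraticChar F x' →
        quadraticChar F y = quadraticChar F y' → M x y = M x' y' := by
  constructor
  · intro hM x x' y y' hx hy
    obtain ⟨g, rfl⟩ := mem_orbit_square_iff.2 hx
    obtain ⟨h, rfl⟩ := mem_orbit_square_iff.2 hy
    exact hM g h x' y'
  · exact fun hM g h x y =>
      hM _ _ _ _ (quadraticChar_square_smul g x) (quadraticChar_square_smul h y)

end QuadraticCharacter

section PaleyGraph

open MulAction

variable {F : Type*} [Field F] [Fintype F] {hF : Fintype.card F % 4 = 1}

theorem paleyGraph_adj_iff [DecidableEq F] {x y : F} :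
    (paleyGraph F hF).Adj x y ↔ quadraticChar F (x - y) = 1 := by
  constructor
  · rintro ⟨hne, hsq⟩
    exact (quadraticChar_one_iff_isSquare (sub_ne_zero.2 hne)).2 hsq
  · intro h
    have hxy : x - y ≠ 0 := fun h0 => by simp [h0] at h
    exact ⟨sub_ne_zero.1 hxy, (quadraticChar_one_iff_isSquare hxy).1 h⟩

theorem quadraticChar_iso_sub [DecidableEq F] (σ : paleyGraph F hF ≃g paleyGraph F hF) (x y : F) :
    quadraticChar F (σ x - σ y) = quadraticChar F (x - y) := by
  refine quadraticChar_eq_quadraticChar ?_ ?_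
  · rw [sub_eq_zero, sub_eq_zero, σ.injective.eq_iff]
  · rw [← paleyGraph_adj_iff (hF := hF), ← paleyGraph_adj_iff (hF := hF), σ.map_adj_iff]

variable (hF) in
/-- Multiplication by a nonzero square, as an automorphism of the Paley graph. -/
def scaling (g : Subgroup.square Fˣ) : paleyGraph F hF ≃g paleyGraph F hF where
  toEquiv := MulAction.toPerm g
  map_rel_iff' {x y} := by
    classical
    rw [toPerm_apply, toPerm_apply, paleyGraph_adj_iff, paleyGraph_adj_iff, ← smul_sub,
      quadraticChar_square_smul]

theorem mem_orbit_autStab_iff [DecidableEq F] {x y : F} :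
    x ∈ orbit (autStab (paleyGraph F hF) 0) y ↔ quadraticChar F x = quadraticChar F y := by
  constructor
  · rintro ⟨⟨σ, hσ : σ 0 = 0⟩, rfl⟩
    change quadraticChar F (σ y) = quadraticChar F y
    simpa only [hσ, sub_zero] using quadraticChar_iso_sub σ y 0
  · intro h
    obtain ⟨g, hg⟩ := mem_orbit_square_iff.2 h
    exact ⟨⟨scaling hF g, smul_zero g⟩, hg⟩

theorem paleyGraph_reachable_of_isSquare_sub {x y : F} (h : IsSquare (x - y)) :
    (paleyGraph F hF).Reachable x y := by
  obtain rfl | hne := eq_or_ne x y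
  · rfl
  · exact SimpleGraph.Adj.reachable ⟨hne, h⟩

theorem paleyGraph_preconnected : (paleyGraph F hF).Preconnected := by
  intro x y
  obtain ⟨u, v, huv⟩ := exists_eq_sq_sub_sq (ringChar_ne_two_of_card_mod_four hF) (x - y)
  have hx : IsSquare (x - (x - u ^ 2)) := ⟨u, by ring⟩
  have hy : IsSquare (y - (x - u ^ 2)) := ⟨v, by linear_combination -huv⟩
  exact (paleyGraph_reachable_of_isSquare_sub hx).trans
    (paleyGraph_reachable_of_isSquare_sub hy).symm

theorem quadraticChar_eq_of_edist_eq [DecidableEq F] {x y : F}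
    (h : (paleyGraph F hF).edist 0 x = (paleyGraph F hF).edist 0 y) :
    quadraticChar F x = quadraticChar F y := by
  have hneg (z : F) : quadraticChar F (0 - z) = quadraticChar F z := by
    rw [zero_sub, quadraticChar_neg_of_card_mod_four hF]
  refine quadraticChar_eq_quadraticChar ?_ ?_
  · rw [eq_comm, ← SimpleGraph.edist_eq_zero_iff (G := paleyGraph F hF), h,
      SimpleGraph.edist_eq_zero_iff, eq_comm]
  · rw [← hneg x, ← hneg y, ← paleyGraph_adj_iff (hF := hF), ← paleyGraph_adj_iff (hF := hF),
      ← SimpleGraph.edist_eq_one_iff_adj, ← SimpleGraph.edist_eq_one_iff_adj, h]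

theorem T₂_paleyGraph_eq_T₃ [DecidableEq F] : T₂ (paleyGraph F hF) 0 = T₃ (paleyGraph F hF) 0 :=
  T₂_eq_T₃_of_transitive_on_spheres paleyGraph_preconnected fun _ _ h =>
    mem_orbit_autStab_iff.2 (quadraticChar_eq_of_edist_eq h)

theorem exists_eq_mul_of_mem_autStab (hprime : (Fintype.card F).Prime)
    {σ : paleyGraph F hF ≃g paleyGraph F hF} (hσ : σ ∈ autStab (paleyGraph F hF) 0) :
    ∃ a, ∀ x, σ x = a * x := by
  classical
  have hcard := two_mul_card_quadraticChar_ne_one (ringChar_ne_two_of_card_mod_four hF)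
  have hinj : ∀ c ∈ Finset.univ.filter fun c : F => quadraticChar F c ≠ 1,
      Function.Injective fun x => σ x - c * x := by
    -- Otherwise `c` is a quotient of differences `(σ x - σ y) / (x - y)`, which are squares.
    intro c hc x y hxy
    by_contra! hne
    have hχ := quadraticChar_sq_one (sub_ne_zero.2 hne)
    have hiso := quadraticChar_iso_sub σ x y
    rw [show σ x - σ y = c * (x - y) by linear_combination hxy, map_mul] at hiso
    refine (Finset.mem_filter.1 hc).2 ?_
    linear_combination quadraticChar F (x - y) * hiso + (1 - quadraticChar F c) * hχ
  obtain ⟨a, b, hab⟩ := exists_eq_mul_add_of_injective_sub_mul hprime (by omega) hinj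
  have hσ0 : σ 0 = 0 := hσ
  refine ⟨a, fun x => ?_⟩
  linear_combination hab x - hab 0 + hσ0

end PaleyGraph

section Jacobsthal

variable {F : Type*} [Field F] [Fintype F] [DecidableEq F] {hF : Fintype.card F % 4 = 1}

variable (F) in
/-- The Jacobsthal matrix `Q` of `F`, whose `(x, y)`-entry is the quadratic character of `x - y`. -/
def jacobsthal : Matrix F F ℂ :=
  Matrix.of fun x y => (quadraticChar F (x - y) : ℂ)

theorem jacobsthal_apply (x y : F) : jacobsthal F x y = quadraticChar F (x - y) := rfl

theorem jacobsthal_mem_invariantMatrices :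
    jacobsthal F ∈ invariantMatrices ℂ (Subgroup.square Fˣ) F := fun g x y => by
  rw [jacobsthal_apply, jacobsthal_apply, ← smul_sub, quadraticChar_square_smul]

omit [Fintype F] [DecidableEq F] in
theorem const_mem_biinvariantMatrices (c : ℂ) :
    (Matrix.of fun _ _ => c) ∈ biinvariantMatrices ℂ (Subgroup.square Fˣ) F :=
  fun _ _ _ _ => rfl

theorem jacobsthal_mul_self (hF : Fintype.card F % 4 = 1) :
    jacobsthal F * jacobsthal F =
      (Fintype.card F : ℂ) • (1 : Matrix F F ℂ) - Matrix.of fun _ _ => 1 := by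
  ext x y
  have hsum := sum_quadraticChar_sub_mul_quadraticChar_sub (ringChar_ne_two_of_card_mod_four hF) x y
  rw [quadraticChar_neg_one_of_card_mod_four hF, one_mul] at hsum
  simp only [Matrix.mul_apply, jacobsthal_apply, Matrix.sub_apply, Matrix.smul_apply,
    Matrix.one_apply, Matrix.of_apply]
  rw [show ∑ z, (quadraticChar F (x - z) : ℂ) * quadraticChar F (z - y) =
    ((∑ z, quadraticChar F (x - z) * quadraticChar F (z - y) : ℤ) : ℂ) by push_cast; rfl, hsum]
  split_ifs <;> simp

theorem adjMat_paleyGraph :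
    adjMat (paleyGraph F hF) = (2⁻¹ : ℂ) • (jacobsthal F + (Matrix.of fun _ _ => 1) - 1) := by
  ext x y
  have hadj : adjMat (paleyGraph F hF) x y = if quadraticChar F (x - y) = 1 then 1 else 0 := by
    classical
    rw [adjMat, SimpleGraph.adjMatrix_apply]
    exact if_congr paleyGraph_adj_iff rfl rfl
  rw [hadj]
  simp only [Matrix.smul_apply, Matrix.sub_apply, Matrix.add_apply, jacobsthal_apply,
    Matrix.of_apply, Matrix.one_apply, smul_eq_mul]
  obtain rfl | hne := eq_or_ne x y
  · simp
  · rcases quadraticChar_dichotomy (sub_ne_zero.2 hne) with h | h <;>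
      norm_num [h, hne, -quadraticChar_apply]

end Jacobsthal

section FirstAlgebra

variable {F : Type*} [Field F] [Fintype F] [DecidableEq F]

theorem smul_one_add_smul_jacobsthal_mem_invariantMatrices (a b : ℂ) :
    a • 1 + b • jacobsthal F ∈ invariantMatrices ℂ (Subgroup.square Fˣ) F :=
  add_mem (Subalgebra.smul_mem _ (one_mem _) a)
    (Subalgebra.smul_mem _ jacobsthal_mem_invariantMatrices b)

/-- The matrices that differ from a linear combination of `1` and the Jacobsthal matrix by a
biinvariant matrix. They form an algebra containing `T₁`. -/
def jacobsthalAlgebra (hF : Fintype.card F % 4 = 1) : Subalgebra ℂ (Matrix F F ℂ) where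
  carrier := {M | ∃ a b : ℂ,
    M - (a • 1 + b • jacobsthal F) ∈ biinvariantMatrices ℂ (Subgroup.square Fˣ) F}
  mul_mem' := by
    rintro M N ⟨a, b, hM⟩ ⟨c, d, hN⟩
    refine ⟨a * c + b * d * Fintype.card F, a * d + b * c, ?_⟩
    have hP := smul_one_add_smul_jacobsthal_mem_invariantMatrices (F := F) a b
    have hR := smul_one_add_smul_jacobsthal_mem_invariantMatrices (F := F) c d
    have hM' : M ∈ invariantMatrices ℂ (Subgroup.square Fˣ) F := by
      simpa using add_mem (mem_invariantMatrices_of_mem_biinvariantMatrices hM) hP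
    have hPR : (a • 1 + b • jacobsthal F) * (c • 1 + d • jacobsthal F) =
        (a * c + b * d * Fintype.card F) • (1 : Matrix F F ℂ) + (a * d + b * c) • jacobsthal F -
          (b * d) • Matrix.of fun _ _ => 1 := by
      simp only [add_mul, mul_add, smul_mul_smul_comm, mul_one, one_mul, jacobsthal_mul_self hF]
      module
    convert sub_mem (add_mem (mul_mem_biinvariantMatrices_left hM' hN)
      (mul_mem_biinvariantMatrices_right hM hR))
      (Submodule.smul_mem _ (b * d) (const_mem_biinvariantMatrices (F := F) 1)) using 1
    rw [← eq_sub_iff_add_eq.1 hPR, mul_sub, sub_mul]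
    abel
  add_mem' := by
    rintro M N ⟨a, b, hM⟩ ⟨c, d, hN⟩
    refine ⟨a + c, b + d, ?_⟩
    convert add_mem hM hN using 1
    module
  algebraMap_mem' c := ⟨c, 0, by simp [Algebra.algebraMap_eq_smul_one]⟩

theorem T₁_paleyGraph_le_jacobsthalAlgebra (hF : Fintype.card F % 4 = 1) :
    T₁ (paleyGraph F hF) 0 ≤ jacobsthalAlgebra hF := by
  refine Algebra.adjoin_le ?_
  rintro _ (rfl | rfl)
  · refine ⟨-2⁻¹, 2⁻¹, ?_⟩
    rw [adjMat_paleyGraph]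
    convert const_mem_biinvariantMatrices (F := F) (2⁻¹ : ℂ) using 1
    ext x y
    simp
    ring
  · refine ⟨0, 0, mem_biinvariantMatrices_square_iff.2 fun x x' y y' hx hy => ?_⟩
    have hx0 : x = 0 ↔ x' = 0 := by
      rw [← quadraticChar_eq_zero_iff, hx, quadraticChar_eq_zero_iff]
    have hy0 : y = 0 ↔ y' = 0 := by
      rw [← quadraticChar_eq_zero_iff, hy, quadraticChar_eq_zero_iff]
    simp only [zero_smul, add_zero, sub_zero, diagIdem_apply, Set.mem_singleton_iff]
    refine if_congr ?_ rfl rfl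
    grind

theorem apply_eq_apply_of_diagonal_mem_jacobsthalAlgebra {hF : Fintype.card F % 4 = 1} {d : F → ℂ}
    (hd : Matrix.diagonal d ∈ jacobsthalAlgebra hF) {x y : F} (hx : x ≠ 0) (hy : y ≠ 0) :
    d x = d y := by
  obtain ⟨a, b, hN⟩ := hd
  have hN := mem_biinvariantMatrices_square_iff.1 hN
  have hb : b = 0 := by
    -- For a nonsquare `n`, the entries `χ (1 - n)` and `χ (1 - n⁻¹)` of `Q` have opposite signs.
    obtain ⟨n, hn⟩ := quadraticChar_exists_neg_one (ringChar_ne_two_of_card_mod_four hF)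
    have hn0 : n ≠ 0 := fun h0 => by simp [h0] at hn
    have hn1 : n ≠ 1 := fun h1 => by simp [h1] at hn
    have hn1' : 1 ≠ n⁻¹ := fun h1 => hn1 (inv_eq_one.1 h1.symm)
    have hinv : quadraticChar F (1 - n⁻¹) = -quadraticChar F (1 - n) := by
      rw [show 1 - n⁻¹ = n⁻¹ * -(1 - n) by field_simp; ring, map_mul,
        quadraticChar_neg_of_card_mod_four hF, quadraticChar_inv, hn, neg_one_mul]
    have h := hN 1 1 n n⁻¹ rfl (quadraticChar_inv n).symm
    rcases quadraticChar_dichotomy (sub_ne_zero.2 hn1.symm) with hs | hs <;>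
      simpa [jacobsthal_apply, hinv, hs, hn1.symm, hn1', self_eq_neg, neg_eq_self,
        -quadraticChar_apply] using h
  have hconst {z : F} (hz : z ≠ 0) : d z = a := by
    have hzz : z ≠ -z := fun h => hz <|
      (Ring.eq_self_iff_eq_zero_of_char_ne_two (ringChar_ne_two_of_card_mod_four hF)).1 h.symm
    have h := hN z z z (-z) rfl (quadraticChar_neg_of_card_mod_four hF z).symm
    simpa [hb, hzz, sub_eq_zero] using h
  rw [hconst hx, hconst hy]

theorem T₁_paleyGraph_lt_T₂ (hF : Fintype.card F % 4 = 1) :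
    T₁ (paleyGraph F hF) 0 < T₂ (paleyGraph F hF) 0 := by
  refine (T₁_le_T₂ _ _).lt_of_ne fun h => ?_
  have hmem : diagIdem (sphere (paleyGraph F hF) 0 1) ∈ T₁ (paleyGraph F hF) 0 :=
    h ▸ Algebra.subset_adjoin (Or.inr ⟨1, rfl⟩)
  obtain ⟨n, hn⟩ := quadraticChar_exists_neg_one (ringChar_ne_two_of_card_mod_four hF)
  have hn0 : n ≠ 0 := fun h0 => by simp [h0] at hn
  have heq := apply_eq_apply_of_diagonal_mem_jacobsthalAlgebra
    (T₁_paleyGraph_le_jacobsthalAlgebra hF hmem) one_ne_zero hn0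
  have hmem_sphere (x : F) : x ∈ sphere (paleyGraph F hF) 0 1 ↔ quadraticChar F x = 1 := by
    change (paleyGraph F hF).edist 0 x = 1 ↔ _
    rw [SimpleGraph.edist_eq_one_iff_adj, paleyGraph_adj_iff, zero_sub,
      quadraticChar_neg_of_card_mod_four hF]
  simp [hmem_sphere, hn, -quadraticChar_apply] at heq

end FirstAlgebra

section ThirdAlgebra

variable {F : Type*} [Field F] [DecidableEq F]

/-- The matrix of the dilation `x ↦ c * x`, acting on functions by composition. For suitable `c` it
separates `T₄` from `T₃`. -/
def dilation (c : F) : Matrix F F ℂ :=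
  Matrix.of fun x y => if y = c * x then 1 else 0

theorem dilation_apply (c x y : F) : dilation c x y = if y = c * x then 1 else 0 := rfl

variable [Fintype F] {hF : Fintype.card F % 4 = 1}

theorem dilation_mem_T₄_paleyGraph (hprime : (Fintype.card F).Prime) (c : F) :
    dilation c ∈ T₄ (paleyGraph F hF) 0 := by
  intro σ hσ x y
  obtain ⟨a, ha⟩ := exists_eq_mul_of_mem_autStab hprime hσ
  have hcomm : σ (c * x) = c * σ x := by rw [ha, ha, mul_left_comm]
  simp only [dilation_apply, ← hcomm, σ.injective.eq_iff]

variable (F) in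
/-- The matrix of the involution `x ↦ x⁻¹` (fixing `0`), twisted by the quadratic character.
The elements of `T₃` commute with it modulo biinvariant matrices. -/
def twistedInversion : Matrix F F ℂ :=
  Matrix.of fun x y => if y = x⁻¹ then (quadraticChar F x : ℂ) else 0

theorem twistedInversion_commutator_apply (M : Matrix F F ℂ) (x y : F) :
    (twistedInversion F * M - M * twistedInversion F) x y =
      quadraticChar F x * M x⁻¹ y - quadraticChar F y * M x y⁻¹ := by
  have hinv (z : F) : y = z⁻¹ ↔ z = y⁻¹ := by rw [eq_comm, inv_eq_iff_eq_inv]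
  simp [Matrix.mul_apply, twistedInversion, hinv, quadraticChar_inv, mul_comm,
    -quadraticChar_apply]

theorem jacobsthal_mem_centralizerModBiinvariant (hF : Fintype.card F % 4 = 1) :
    jacobsthal F ∈ centralizerModBiinvariant (Subgroup.square Fˣ) (twistedInversion F) := by
  have hcomm (x y : F) :
      (twistedInversion F * jacobsthal F - jacobsthal F * twistedInversion F) x y =
        quadraticChar F x ^ 2 - quadraticChar F y ^ 2 := by
    have hneg := quadraticChar_neg_of_card_mod_four hF
    rw [twistedInversion_commutator_apply, jacobsthal_apply, jacobsthal_apply]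
    norm_cast
    rw [← map_mul, ← map_mul, mul_sub, mul_sub]
    obtain rfl | hx := eq_or_ne x 0
    · obtain rfl | hy := eq_or_ne y 0
      · simp
      · simp [hneg, hy, quadraticChar_zero, quadraticChar_sq_one hy, -quadraticChar_apply]
    · obtain rfl | hy := eq_or_ne y 0
      · simp [hx, quadraticChar_zero, quadraticChar_sq_one hx, -quadraticChar_apply]
      · rw [mul_inv_cancel₀ hx, mul_inv_cancel₀ hy, quadraticChar_sq_one hx,
          quadraticChar_sq_one hy, ← hneg (y * x - 1), neg_sub, mul_comm y x, sub_self, sub_self]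
  refine ⟨jacobsthal_mem_invariantMatrices, mem_biinvariantMatrices_square_iff.2 ?_⟩
  intro x x' y y' hx hy
  rw [hcomm, hcomm, hx, hy]

theorem const_mem_centralizerModBiinvariant (c : ℂ) :
    (Matrix.of fun _ _ => c) ∈
      centralizerModBiinvariant (Subgroup.square Fˣ) (twistedInversion F) := by
  refine ⟨fun _ _ _ => rfl, mem_biinvariantMatrices_square_iff.2 ?_⟩
  intro x x' y y' hx hy
  simp only [twistedInversion_commutator_apply, Matrix.of_apply, hx, hy]

theorem diagIdem_mem_centralizerModBiinvariant {Y : Set F}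
    (hY : ∀ x y, quadraticChar F x = quadraticChar F y → (x ∈ Y ↔ y ∈ Y)) :
    diagIdem Y ∈ centralizerModBiinvariant (Subgroup.square Fˣ) (twistedInversion F) := by
  classical
  refine ⟨fun g x y => ?_, ?_⟩
  · simp only [diagIdem_apply, smul_left_cancel_iff, hY _ _ (quadraticChar_square_smul g x)]
  · suffices hcomm : twistedInversion F * diagIdem Y - diagIdem Y * twistedInversion F = 0 by
      rw [hcomm]
      exact zero_mem _
    ext x y
    rw [twistedInversion_commutator_apply, diagIdem_apply, diagIdem_apply, Matrix.zero_apply]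
    by_cases hxy : x⁻¹ = y
    · subst hxy
      simp [quadraticChar_inv, hY _ _ (quadraticChar_inv x), -quadraticChar_apply]
    · have hyx : x ≠ y⁻¹ := fun h => hxy (by rw [h, inv_inv])
      simp [hxy, hyx]

theorem T₃_paleyGraph_le_centralizerModBiinvariant (hF : Fintype.card F % 4 = 1) :
    T₃ (paleyGraph F hF) 0 ≤
      centralizerModBiinvariant (Subgroup.square Fˣ) (twistedInversion F) := by
  refine Algebra.adjoin_le ?_
  rintro _ (rfl | ⟨y, rfl⟩)
  · rw [adjMat_paleyGraph]
    exact Subalgebra.smul_mem _ (sub_mem (add_mem (jacobsthal_mem_centralizerModBiinvariant hF)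
      (const_mem_centralizerModBiinvariant 1)) (one_mem _)) _
  · refine diagIdem_mem_centralizerModBiinvariant fun x z hxz => ?_
    rw [mem_orbit_autStab_iff, mem_orbit_autStab_iff, hxz]

theorem dilation_sq_notMem_centralizerModBiinvariant {s : F} (hs0 : s ≠ 0) (hs : s ^ 4 ≠ 1) :
    dilation (s ^ 2) ∉ centralizerModBiinvariant (Subgroup.square Fˣ) (twistedInversion F) := by
  intro h
  have hentry := mem_biinvariantMatrices_square_iff.1 h.2 1 1 1 (s ^ 2) rfl
    (by rw [map_one, quadraticChar_sq_one' hs0])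
  have hinv : (s ^ 2)⁻¹ ≠ s ^ 2 := fun h => hs <| by
    rw [pow_mul s 2 2, sq (s ^ 2)]
    nth_rw 1 [← h]
    exact inv_mul_cancel₀ (pow_ne_zero 2 hs0)
  rw [twistedInversion_commutator_apply, twistedInversion_commutator_apply] at hentry
  simp [dilation_apply, hinv, -quadraticChar_apply] at hentry

theorem T₃_paleyGraph_lt_T₄ (hprime : (Fintype.card F).Prime) (hcard : 5 < Fintype.card F) :
    T₃ (paleyGraph F hF) 0 < T₄ (paleyGraph F hF) 0 := by
  obtain ⟨s, hs⟩ := exists_pow_ne_one_of_isCyclic (G := Fˣ) (k := 4) (by norm_num) (by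
    rw [Nat.card_eq_fintype_card, Fintype.card_units]; omega)
  have hs' : (s : F) ^ 4 ≠ 1 := fun h => hs (Units.ext h)
  refine (T₃_le_T₄ _ _).lt_of_ne fun h => ?_
  refine dilation_sq_notMem_centralizerModBiinvariant s.ne_zero hs' ?_
  exact T₃_paleyGraph_le_centralizerModBiinvariant hF (h ▸ dilation_mem_T₄_paleyGraph hprime _)

end ThirdAlgebra

theorem mainTheorem1_general (F : Type*) [Field F] [Fintype F] [DecidableEq F]
    (hF : Fintype.card F % 4 = 1) :
    T₁ (paleyGraph F hF) 0 < T₂ (paleyGraph F hF) 0 ∧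
      T₂ (paleyGraph F hF) 0 = T₃ (paleyGraph F hF) 0 ∧
      ((Fintype.card F).Prime → 5 < Fintype.card F →
        T₃ (paleyGraph F hF) 0 < T₄ (paleyGraph F hF) 0) :=
  ⟨T₁_paleyGraph_lt_T₂ hF, T₂_paleyGraph_eq_T₃, T₃_paleyGraph_lt_T₄⟩

end TerwilligerPaley

open TerwilligerPaley in
theorem mainTheorem1 :
    (∀ (p : ℕ) [Fact p.Prime] (hp : p % 4 = 1), 7 ≤ p →
      T₁ (paley p hp) 0 < T₂ (paley p hp) 0 ∧
      T₂ (paley p hp) 0 = T₃ (paley p hp) 0 ∧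
      T₃ (paley p hp) 0 < T₄ (paley p hp) 0) ∧
    Set.Infinite {p : ℕ | ∃ (_ : Fact p.Prime) (hp : p % 4 = 1),
      T₃ (paley p hp) 0 ≠ T₄ (paley p hp) 0} := by
  have hT (p : ℕ) [Fact p.Prime] (hp : p % 4 = 1) (h7 : 7 ≤ p) :
      T₁ (paley p hp) 0 < T₂ (paley p hp) 0 ∧ T₂ (paley p hp) 0 = T₃ (paley p hp) 0 ∧
        T₃ (paley p hp) 0 < T₄ (paley p hp) 0 := by
    have hcard := ZMod.card p
    obtain ⟨h₁₂, h₂₃, h₃₄⟩ := mainTheorem1_general (ZMod p) (by rw [hcard]; exact hp)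
    exact ⟨h₁₂, h₂₃, h₃₄ (by rw [hcard]; exact Fact.out) (by omega)⟩
  refine ⟨hT, ((Nat.infinite_setOfPred_prime_modEq_one (k := 4) (by norm_num)).sdiff
    (Set.finite_Iio 7)).mono ?_⟩
  rintro p ⟨⟨hp, hmod⟩, h7⟩
  have hfact := Fact.mk hp
  exact ⟨hfact, hmod, (hT p hmod (not_lt.1 h7)).2.2.ne⟩
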